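/- Let $\mathcal A$ be a finite alphabet, let $K\ge 1$, let $\mathbf T=(\mathbb R/\mathbb Z)^K$ with Lebesgue (Haar) probability measure $\lambda$, and let $\tau:\mathbb Z\to\mathbf T$ be an injective group homomorphism with dense image; write $\varsigma^{\ell}(t)=t+\tau(\ell)$ (for $K=1$ this is an irrational rotation of the circle). An $\mathcal A$-labelled measurable partition is a family $\mathcal P=(\mathbf P_a)_{a\in\mathcal A}$ of pairwise disjoint measurable subsets of $\mathbf T$ with $\lambda(\bigcup_a\mathbf P_a)=1$; it is an open partition if moreover every $\mathbf P_a$ is open and $\bigcup_a\mathbf P_a$ is dense. Let $\mathrm{MP}$ and $\mathrm{OP}$ be the sets of measurable and of open partitions, with the symmetric difference distance $d_\Delta(\mathcal P,\mathcal Q)=\sum_{a}\lambda(\mathbf P_a\,\triangle\,\mathbf Q_a)$. Let $\mathrm{QS}\subseteq\mathcal A^{\mathbb Z}$ be the set of $\varsigma$-quasisturmian sequences, i.e. of all $p\in\mathcal A^{\mathbb Z}$ for which there are $\mathcal P\in \mathrm{OP}$ and $t\in\mathbf T$ with $\varsigma^{\ell}(t)\in\mathbf P_{p_\ell}$ for all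 $\ell\in\mathbb Z$. On $\mathcal A^{\mathbb Z}$ let $d_C(p,q)=2^{-\min\{|\ell|\,:\,p_\ell\ne q_\ell\}}$ (and $d_C(p,p)=0$) be the Cantor metric, and $d_B(p,q)=\limsup_{N\to\infty}\frac{1}{2N}\#\{\ell\in[-N,N)\cap\mathbb Z: p_\ell\neq q_\ell\}$ the Besicovitch pseudometric. Let $\Phi:\mathcal A^{\mathbb Z}\to\mathcal A^{\mathbb Z}$ be any cellular automaton (a continuous map commuting with all shifts), and let $\phi:\mathcal A^{B}\to\mathcal A$, with $B\subset\mathbb Z$ finite, be any local map of $\Phi$ (every cellular automaton has one), so that $\Phi(x)_\ell=\phi([x_{\ell+b}]_{b\in B})$. Let $\Phi_*$ be the induced map on partitions, $\Phi_*(\mathcal P)=(\mathbf Q_a)_{a\in\mathcal A}$ with $$\mathbf Q_a=\bigcup_{c\in\mathcal A^B,\ \phi(c)=a}\ \bigcap_{b\in B}\varsigma^{-b}(\mathbf P_{c_b}).$$ Then the following are equivalent: (a) $\Phi$ is surjective onto $\mathcal A^{\mathbb Z}$; (b) $\Phi_*(\mathrm{MP})$ is a $d_\Delta$-dense subset of $\mathrm{MP}$,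 and $\Phi_*(\mathrm{OP})$ is a $d_\Delta$-dense subset of $\mathrm{OP}$; (c) $\Phi(\mathrm{QS})$ is a $d_B$-dense subset of $\mathrm{QS}$; (d) $\Phi(\mathrm{QS})$ is a $d_C$-dense subset of $\mathrm{QS}$. -/

import Mathlib

open MeasureTheory Set Filter

noncomputable section

namespace QuasiSturm

/-! ### Configurations, cellular automata, local maps -/

/-- The shift `σ^v` on `𝒜^ℤ`: `σ^v(x)_ℓ = x_{ℓ - v}`. -/
def shift {𝒜 : Type*} (v : ℤ) (x : ℤ → 𝒜) : ℤ → 𝒜 := fun ℓ => x (ℓ - v)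

/-- A cellular automaton on `𝒜^ℤ`: a map that is continuous for the product topology (`𝒜` carries
its discrete topology wherever this is used) and commutes with all shifts. -/
structure IsCellularAutomaton {𝒜 : Type*} [TopologicalSpace 𝒜]
    (Φ : (ℤ → 𝒜) → (ℤ → 𝒜)) : Prop where
  continuous : Continuous Φ
  shift_comm : ∀ (v : ℤ) (x : ℤ → 𝒜), shift v (Φ x) = Φ (shift v x)

/-- `φ : 𝒜^B → 𝒜`, with `B ⊂ ℤ` finite, is a local map of `Φ`:
`Φ(x)_ℓ = φ([x_{ℓ+b}]_{b ∈ B})`. -/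
def IsLocalMap {𝒜 : Type*} (Φ : (ℤ → 𝒜) → (ℤ → 𝒜)) (B : Finset ℤ) (φ : (B → 𝒜) → 𝒜) : Prop :=
  ∀ (x : ℤ → 𝒜) (ℓ : ℤ), Φ x ℓ = φ (fun b => x (ℓ + b))

/-- Every cellular automaton over a finite alphabet has a local map (Curtis, Hedlund, Lyndon). -/
theorem IsCellularAutomaton.exists_isLocalMap {𝒜 : Type*} [Finite 𝒜] [TopologicalSpace 𝒜]
    [DiscreteTopology 𝒜] {Φ : (ℤ → 𝒜) → (ℤ → 𝒜)} (hΦ : IsCellularAutomaton Φ) :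
    ∃ (B : Finset ℤ) (φ : (B → 𝒜) → 𝒜), IsLocalMap Φ B φ := by
  classical
  have h0 : Continuous fun x => Φ x 0 := (continuous_apply 0).comp hΦ.continuous
  have hloc : ∀ x : ℤ → 𝒜, ∃ F : Finset ℤ, ∀ y : ℤ → 𝒜,
      (∀ i ∈ F, y i = x i) → Φ y 0 = Φ x 0 := by
    intro x
    have hopen : IsOpen ((fun y => Φ y 0) ⁻¹' {Φ x 0}) := (isOpen_discrete _).preimage h0
    obtain ⟨I, u, hu, hsub⟩ := isOpen_pi_iff.1 hopen x rfl
    refine ⟨I, fun y hy => hsub fun i hi => ?_⟩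
    rw [hy i hi]
    exact (hu i hi).2
  choose F hF using hloc
  obtain ⟨s, hs⟩ := isCompact_univ.elim_finite_subcover
    (fun x : ℤ → 𝒜 => {y : ℤ → 𝒜 | ∀ i ∈ F x, y i = x i})
    (fun x => by
      have : {y : ℤ → 𝒜 | ∀ i ∈ F x, y i = x i} = Set.pi (F x : Set ℤ) fun i => {x i} := by
        ext y; simp [Set.mem_pi]
      rw [this]
      exact isOpen_set_pi (F x).finite_toSet fun i _ => isOpen_discrete _)
    (fun x _ => Set.mem_iUnion.2 ⟨x, fun _ _ => rfl⟩)
  let B : Finset ℤ := insert 0 (s.biUnion F)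
  have hB0 : (0 : ℤ) ∈ B := Finset.mem_insert_self _ _
  have hdep : ∀ y z : ℤ → 𝒜, (∀ i ∈ B, y i = z i) → Φ y 0 = Φ z 0 := by
    intro y z hyz
    obtain ⟨x, hx, hxz⟩ := Set.mem_iUnion₂.1 (hs (Set.mem_univ z))
    rw [hF x z hxz]
    refine hF x y fun i hi => ?_
    rw [hyz i (Finset.mem_insert_of_mem (Finset.mem_biUnion.2 ⟨x, hx, hi⟩))]
    exact hxz i hi
  refine ⟨B, fun c => Φ (fun i => if h : i ∈ B then c ⟨i, h⟩ else c ⟨0, hB0⟩) 0, ?_⟩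
  intro x ℓ
  have h1 : Φ x ℓ = Φ (shift (-ℓ) x) 0 := by
    rw [← hΦ.shift_comm]; simp [shift]
  rw [h1]
  refine hdep _ _ fun i hi => ?_
  simp only [shift, hi, dite_true]
  congr 1
  ring

/-! ### Cantor and Besicovitch distances -/

open Classical in
/-- The Cantor metric `d_C(p, q) = 2^{-D(p,q)}`, `D(p,q) = min {|ℓ| ; p_ℓ ≠ q_ℓ}`
(and `0` if `p = q`). -/
def cantorDist {𝒜 : Type*} (p q : ℤ → 𝒜) : ℝ :=
  if p = q then 0 else (1 / 2 : ℝ) ^ sInf {n : ℕ | ∃ ℓ : ℤ, ℓ.natAbs = n ∧ p ℓ ≠ q ℓ}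

/-- The upper Cesàro density of `J ⊂ ℤ`: the limsup of `#(J ∩ [-N, N)) / (2N)`. -/
def upperDensity (J : Set ℤ) : ℝ :=
  limsup (fun N : ℕ => ((J ∩ Set.Ico (-(N : ℤ)) (N : ℤ)).ncard : ℝ) / (2 * (N : ℝ))) atTop

/-- The Besicovitch pseudometric. -/
def besicovitchDist {𝒜 : Type*} (p q : ℤ → 𝒜) : ℝ :=
  upperDensity {ℓ : ℤ | p ℓ ≠ q ℓ}

/-- `S` is a subset of `T` that is dense in `T` with respect to the distance `d`. -/
def IsDenseIn {X : Type*} (d : X → X → ℝ) (S T : Set X) : Prop :=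
  S ⊆ T ∧ ∀ x ∈ T, ∀ ε : ℝ, 0 < ε → ∃ y ∈ S, d x y < ε

/-! ### Partitions of the torus -/

/-- The torus `(ℝ/ℤ)^K`; its `volume` is the Lebesgue (Haar) probability measure. -/
abbrev Torus (K : ℕ) : Type := Fin K → UnitAddCircle

/-- The set of `𝒜`-labelled measurable partitions of the torus. -/
def measPartitions (𝒜 : Type*) (K : ℕ) : Set (𝒜 → Set (Torus K)) :=
  {P | (∀ a, MeasurableSet (P a)) ∧ Pairwise (fun a b => Disjoint (P a) (P b)) ∧
    volume (⋃ a, P a) = 1}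

/-- The set of `𝒜`-labelled open partitions of the torus. -/
def openPartitions (𝒜 : Type*) (K : ℕ) : Set (𝒜 → Set (Torus K)) :=
  {P | (∀ a, IsOpen (P a)) ∧ Pairwise (fun a b => Disjoint (P a) (P b)) ∧
    Dense (⋃ a, P a) ∧ volume (⋃ a, P a) = 1}

/-- The symmetric difference distance of two labelled partitions. -/
def symmDiffDist {𝒜 : Type*} [Fintype 𝒜] {K : ℕ} (P Q : 𝒜 → Set (Torus K)) : ℝ :=
  ∑ a, volume.real (symmDiff (P a) (Q a))

/-! ### The rotation, quasisturmian sequences, the induced map on partitions -/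

/-- The rotation `ς^ℓ` of the torus by `τ(ℓ)`. -/
def rot {K : ℕ} (τ : ℤ →+ Torus K) (ℓ : ℤ) (t : Torus K) : Torus K := t + τ ℓ

/-- The set of `ς`-quasisturmian sequences: the trajectories of points `t` through open partitions
`P`, where the whole orbit of `t` stays in `⋃ a, P a`. As the `P a` are disjoint, the trajectory of
`t` is the one sequence `p` with `ς^ℓ(t) ∈ P_{p_ℓ}` for all `ℓ`, and such a sequence exists
precisely if the whole orbit stays in `⋃ a, P a`. -/
def quasisturmian (𝒜 : Type*) {K : ℕ} (τ : ℤ →+ Torus K) : Set (ℤ → 𝒜) :=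
  {p | ∃ P ∈ openPartitions 𝒜 K, ∃ t : Torus K, ∀ ℓ : ℤ, rot τ ℓ t ∈ P (p ℓ)}

/-- The map induced on partitions by the local map `φ : 𝒜^B → 𝒜`: it takes `P` to `Q`, where
`Q_a` is the union over all `c ∈ 𝒜^B` with `φ(c) = a` of `⋂_{b ∈ B} ς^{-b}(P_{c_b})`. -/
def inducedMap {𝒜 : Type*} {K : ℕ} (τ : ℤ →+ Torus K) (B : Finset ℤ) (φ : (B → 𝒜) → 𝒜)
    (P : 𝒜 → Set (Torus K)) : 𝒜 → Set (Torus K) :=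
  fun a => ⋃ c ∈ {c : B → 𝒜 | φ c = a}, ⋂ b : B, rot τ (-(b : ℤ)) '' P (c b)

end QuasiSturm

end

/-! Surjectivity yields density because a section of `Φ` can be applied block by block. Take as
marker a small ball `V` about `0` with null boundary. Visits of an orbit to `V` are at least `N`
apart, since `τ` is injective, and have bounded gaps, since the torus is compact and `τ` has dense
image. Cut a trajectory at its visits and replace each block by a piece of a `Φ`-preimage of it,
taken from an arbitrary right inverse of `Φ`. That inverse need not be continuous: blocks have
bounded length, so the replacement is a finite-window code and sends open partitions to open
partitions. Applying `Φ` recovers the original except within `r` of a visit, where `r` bounds the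
neighbourhood `B`. The exceptional times have density `O(r/N)`, the exceptional points measure at
most `(2r+1)/N`. This is `exists_coding_of_surjective`; it settles the Besicovitch and symmetric
difference cases. For the Cantor metric it is enough that every finite word is quasisturmian
(`exists_openPartition_word`).

Conversely, if `Φ` is not onto, some word never occurs in its image (`exists_forbidden_word`).
Choose an open partition that reads this word along the orbit of `0`. The cylinder of the word is
open and nonempty, so it has positive measure and is visited with bounded gaps. Each visit forces a
disagreement with any image under `Φ`, which bounds both distances from below; in the Cantor metric
one occurrence of the word suffices. -/

noncomputable section

namespace QuasiSturm

/-! ### Surjectivity and section codings of cellular automata -/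

section Symbolic

variable {𝒜 : Type*}

/-- If a continuous self-map of `𝒜^ℤ` is not onto, some finite word never occurs in its image. -/
theorem exists_forbidden_word [Finite 𝒜] [TopologicalSpace 𝒜] [DiscreteTopology 𝒜]
    {Φ : (ℤ → 𝒜) → (ℤ → 𝒜)} (hΦ : Continuous Φ) (hns : ¬ Function.Surjective Φ) :
    ∃ (M : ℕ) (w : ℤ → 𝒜), ∀ x, ∃ ℓ ∈ Finset.Icc (-(M : ℤ)) M, Φ x ℓ ≠ w ℓ := by
  have hcl : IsClosed (range Φ) := (isCompact_range hΦ).isClosed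
  obtain ⟨w, hw⟩ := not_forall.1 hns
  obtain ⟨I, u, hu, hsub⟩ := isOpen_pi_iff.1 hcl.isOpen_compl w (by simpa using hw)
  refine ⟨I.sup Int.natAbs, w, fun x => ?_⟩
  by_contra! hx
  refine hsub (a := Φ x) (fun i hi => ?_) ⟨x, rfl⟩
  have hi' : i.natAbs ≤ I.sup Int.natAbs := Finset.le_sup (f := Int.natAbs) hi
  rw [hx i (Finset.mem_Icc.2 (by omega))]
  exact (hu i hi).2

theorem exists_finset_int_bound (B : Finset ℤ) : ∃ r : ℕ, ∀ b ∈ B, b.natAbs ≤ r :=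
  ⟨B.sup Int.natAbs, fun _ hb => Finset.le_sup (f := Int.natAbs) hb⟩

/-- Distance from `ℓ` back to the last marked position of `ρ`. -/
def lastMark (ρ : ℤ → 𝒜 × Bool) (ℓ : ℤ) : ℕ := sInf {i : ℕ | (ρ (ℓ - i)).2 = true}

/-- The word of length `M + 1` read from the last mark of `ρ` before `ℓ`, padded with `a₀`. -/
def markedWord (a₀ : 𝒜) (M : ℕ) (ρ : ℤ → 𝒜 × Bool) (ℓ : ℤ) : ℤ → 𝒜 :=
  fun k => if 0 ≤ k ∧ k ≤ M then (ρ (ℓ - lastMark ρ ℓ + k)).1 else a₀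

/-- The configuration obtained by applying `s` separately to each of the words that start at the
marks of `ρ`. -/
def cutLift (s : (ℤ → 𝒜) → (ℤ → 𝒜)) (a₀ : 𝒜) (M : ℕ) (ρ : ℤ → 𝒜 × Bool) (ℓ : ℤ) : 𝒜 :=
  s (markedWord a₀ M ρ ℓ) (lastMark ρ ℓ)

theorem lastMark_mem {ρ : ℤ → 𝒜 × Bool} {ℓ : ℤ} {M : ℕ}
    (h : ∃ i : ℕ, i ≤ M ∧ (ρ (ℓ - i)).2 = true) :
    (ρ (ℓ - lastMark ρ ℓ)).2 = true ∧ lastMark ρ ℓ ≤ M := by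
  obtain ⟨i, hi, hρ⟩ := h
  exact ⟨Nat.sInf_mem (s := {i : ℕ | (ρ (ℓ - i)).2 = true}) ⟨i, hρ⟩, (Nat.sInf_le hρ).trans hi⟩

theorem lastMark_eq {ρ : ℤ → 𝒜 × Bool} {ℓ : ℤ} {i : ℕ} (h : (ρ (ℓ - i)).2 = true)
    (h' : ∀ j : ℕ, j < i → (ρ (ℓ - j)).2 = false) : lastMark ρ ℓ = i := by
  refine le_antisymm (Nat.sInf_le h) (le_csInf ⟨i, h⟩ fun j hj => ?_)
  by_contra! hji
  simp only [mem_ofPred_eq, h' j hji] at hj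
  exact absurd hj (by decide)

theorem false_of_lt_lastMark {ρ : ℤ → 𝒜 × Bool} {ℓ : ℤ} {j : ℕ} (h : j < lastMark ρ ℓ) :
    (ρ (ℓ - j)).2 = false :=
  Bool.eq_false_iff.2 (Nat.notMem_of_lt_sInf (s := {i : ℕ | (ρ (ℓ - i)).2 = true}) h)

/-- Locality of `cutLift`: the last mark lies at most `M` back and the word read from it ends at
most `M` ahead, so the window `[-M, M]` determines the value, however wild `s` is. -/
theorem cutLift_congr (s : (ℤ → 𝒜) → (ℤ → 𝒜)) (a₀ : 𝒜) {M : ℕ} {ρ ρ' : ℤ → 𝒜 × Bool} {ℓ ℓ' : ℤ}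
    (h : ∃ i : ℕ, i ≤ M ∧ (ρ (ℓ - i)).2 = true)
    (hρ : ∀ j : ℤ, -(M : ℤ) ≤ j → j ≤ M → ρ (ℓ + j) = ρ' (ℓ' + j)) :
    cutLift s a₀ M ρ ℓ = cutLift s a₀ M ρ' ℓ' := by
  obtain ⟨h1, h2⟩ := lastMark_mem h
  have key : ∀ j : ℕ, j ≤ M → ρ (ℓ - j) = ρ' (ℓ' - j) := fun j hj => by
    simpa [sub_eq_add_neg] using hρ (-j) (by omega) (by omega)
  have hl : lastMark ρ' ℓ' = lastMark ρ ℓ := by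
    refine lastMark_eq (by rw [← key _ h2, h1]) fun j hj => ?_
    rw [← key j (hj.le.trans h2)]
    exact false_of_lt_lastMark hj
  have hw : markedWord a₀ M ρ ℓ = markedWord a₀ M ρ' ℓ' := by
    funext k
    simp only [markedWord, hl]
    split_ifs with hk
    · have := hρ (-(lastMark ρ ℓ : ℤ) + k) (by omega) (by omega)
      rw [← add_assoc, ← add_assoc, ← sub_eq_add_neg, ← sub_eq_add_neg] at this
      rw [this]
    · rfl
  simp only [cutLift, hw, hl]

/-- Away from the marks, `cutLift` of a section of `Φ` is a preimage under `Φ`. -/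
theorem apply_cutLift {Φ : (ℤ → 𝒜) → (ℤ → 𝒜)} {B : Finset ℤ} {φ : (B → 𝒜) → 𝒜}
    (hφ : IsLocalMap Φ B φ) {s : (ℤ → 𝒜) → (ℤ → 𝒜)} (hs : Function.RightInverse s Φ) (a₀ : 𝒜)
    {M r : ℕ} (hr : ∀ b ∈ B, b.natAbs ≤ r) {ρ : ℤ → 𝒜 × Bool} {ℓ : ℤ}
    (h : ∃ i : ℕ, i ≤ M ∧ (ρ (ℓ - i)).2 = true)
    (hfar : ∀ k : ℤ, k.natAbs ≤ r → (ρ (ℓ + k)).2 = false) :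
    Φ (cutLift s a₀ M ρ) ℓ = (ρ ℓ).1 := by
  obtain ⟨h1, h2⟩ := lastMark_mem h
  set i := lastMark ρ ℓ with hi
  have hri : r < i := by
    by_contra! hle
    have := hfar (-(i : ℤ)) (by omega)
    rw [← sub_eq_add_neg, h1] at this
    exact absurd this (by decide)
  -- No mark lies within `r` of `ℓ`, so all the cells that `Φ` reads at `ℓ` belong to one block and
  -- come from the same preimage.
  have hloc : ∀ k : ℤ, k.natAbs ≤ r →
      cutLift s a₀ M ρ (ℓ + k) = s (markedWord a₀ M ρ ℓ) (i + k) := by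
    intro k hk
    obtain ⟨n, hn⟩ : ∃ n : ℕ, (n : ℤ) = i + k := ⟨(i + k).toNat, by omega⟩
    have hl : lastMark ρ (ℓ + k) = n := by
      refine lastMark_eq ?_ fun j hj => ?_
      · rw [hn, show ℓ + k - (i + k) = ℓ - i by ring, h1]
      -- The cell `ℓ + k - j` is either within `r` of `ℓ`, hence unmarked by `hfar`, or strictly
      -- between the last mark and `ℓ`.
      · by_cases hjk : (j : ℤ) ≤ k + r
        · have := hfar (k - j) (by omega)
          rwa [← add_sub_assoc] at this
        · obtain ⟨m, hm⟩ : ∃ m : ℕ, (m : ℤ) = j - k := ⟨(j - k).toNat, by omega⟩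
          have := false_of_lt_lastMark (ρ := ρ) (ℓ := ℓ) (j := m) (by omega)
          rwa [hm, show ℓ - (j - k) = ℓ + k - j by ring] at this
    have hw : markedWord a₀ M ρ (ℓ + k) = markedWord a₀ M ρ ℓ := by
      funext m
      simp only [markedWord, hl, ← hi, hn]
      rw [show ℓ + k - (i + k) + m = ℓ - i + m by ring]
    rw [cutLift, hw, hl, hn]
  rw [hφ]
  have : (fun b : B => cutLift s a₀ M ρ (ℓ + b)) =
      fun b : B => s (markedWord a₀ M ρ ℓ) ((i : ℤ) + b) :=
    funext fun b => hloc b (hr b b.2)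
  rw [this, ← hφ, hs (markedWord a₀ M ρ ℓ), markedWord, if_pos ⟨by omega, by omega⟩, ← hi]
  congr 2
  ring

end Symbolic

/-! ### Upper densities -/

/-- Cut `[-n, n)` into blocks of length `N`, the last possibly shorter: an `N`-separated set has at
most one point in each, so the block index is injective on it. -/
theorem ncard_inter_Ico_le {S : Set ℤ} {N : ℕ} (hN : 0 < N)
    (hS : ∀ ℓ ∈ S, ∀ i : ℕ, 0 < i → i < N → ℓ + i ∉ S) (n : ℕ) :
    (S ∩ Ico (-(n : ℤ)) n).ncard ≤ 2 * n / N + 1 := by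
  have hsub : ((fun ℓ : ℤ => (ℓ + n) / N) '' (S ∩ Ico (-(n : ℤ)) n)).ncard ≤
      (Ico (0 : ℤ) ((2 * n / N + 1 : ℕ) : ℤ)).ncard := by
    refine ncard_le_ncard ?_ (finite_Ico _ _)
    rintro _ ⟨ℓ, ⟨-, h1, h2⟩, rfl⟩
    have hN' : (0 : ℤ) < N := by exact_mod_cast hN
    refine ⟨Int.ediv_nonneg (by omega) hN'.le, ?_⟩
    have : (ℓ + n) / N ≤ (2 * n : ℤ) / N := Int.ediv_le_ediv hN' (by omega)
    push_cast
    omega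
  have hinj : InjOn (fun ℓ : ℤ => (ℓ + n) / N) (S ∩ Ico (-(n : ℤ)) n) := by
    have aux : ∀ a ∈ S, ∀ b ∈ S, (a + n) / N = (b + n) / N → ¬ a < b := by
      intro a ha b hb hab hlt
      have hN' : (0 : ℤ) < N := by exact_mod_cast hN
      have e1 := Int.emod_add_mul_ediv (a + n) N
      have e2 := Int.emod_add_mul_ediv (b + n) N
      rw [hab] at e1
      have l1 := Int.emod_nonneg (a + n) hN'.ne'
      have l2 := Int.emod_lt_of_pos (b + n) hN'
      refine hS a ha (b - a).toNat (by omega) (by omega) ?_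
      rwa [show a + ((b - a).toNat : ℤ) = b by omega]
    intro a ha b hb hab
    exact le_antisymm (not_lt.1 (aux b hb.1 a ha.1 hab.symm)) (not_lt.1 (aux a ha.1 b hb.1 hab))
  rw [hinj.ncard_image, ← Finset.coe_Ico (0 : ℤ), ncard_coe_finset, Int.card_Ico,
    sub_zero, Int.toNat_natCast] at hsub
  exact hsub

theorem ncard_inter_Ico_le_two_mul (J : Set ℤ) (n : ℕ) :
    (J ∩ Ico (-(n : ℤ)) n).ncard ≤ 2 * n := by
  refine (ncard_le_ncard inter_subset_right (finite_Ico _ _)).trans_eq ?_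
  rw [← Finset.coe_Ico, ncard_coe_finset, Int.card_Ico]
  omega

theorem density_ratio_le_one (J : Set ℤ) (n : ℕ) :
    ((J ∩ Ico (-(n : ℤ)) n).ncard : ℝ) / (2 * (n : ℝ)) ≤ 1 := by
  refine div_le_one_of_le₀ ?_ (by positivity)
  exact_mod_cast ncard_inter_Ico_le_two_mul J n

/-- A set that stays within `r` of an `N`-separated set has small upper density. -/
theorem upperDensity_le_of_separated {S J : Set ℤ} {N r : ℕ} (hN : 0 < N)
    (hS : ∀ ℓ ∈ S, ∀ i : ℕ, 0 < i → i < N → ℓ + i ∉ S)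
    (hJ : ∀ ℓ ∈ J, ∃ k : ℤ, k.natAbs ≤ r ∧ ℓ + k ∈ S) :
    upperDensity J ≤ 2 * (2 * r + 1) / N := by
  have hcob : IsCoboundedUnder (· ≤ ·) atTop
      (fun n : ℕ => ((J ∩ Ico (-(n : ℤ)) n).ncard : ℝ) / (2 * (n : ℝ))) :=
    (isBoundedUnder_of ⟨0, fun n => by positivity⟩ :
      IsBoundedUnder (· ≥ ·) atTop _).isCoboundedUnder_le
  refine limsup_le_of_le hcob ?_
  filter_upwards [eventually_ge_atTop N] with n hn
  have hcard : (J ∩ Ico (-(n : ℤ)) n).ncard ≤ (2 * r + 1) * (2 * n / N + 1) := by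
    have hsub : J ∩ Ico (-(n : ℤ)) n ⊆
        ⋃ k ∈ Finset.Icc (-(r : ℤ)) r, {ℓ | ℓ + k ∈ S} ∩ Ico (-(n : ℤ)) n := by
      rintro ℓ ⟨hℓ, hI⟩
      obtain ⟨k, hk, hkS⟩ := hJ ℓ hℓ
      exact mem_iUnion₂.2 ⟨k, Finset.mem_Icc.2 (by omega), hkS, hI⟩
    calc (J ∩ Ico (-(n : ℤ)) n).ncard
        ≤ (⋃ k ∈ Finset.Icc (-(r : ℤ)) r, {ℓ | ℓ + k ∈ S} ∩ Ico (-(n : ℤ)) n).ncard :=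
          ncard_le_ncard hsub (Finite.biUnion (Finset.finite_toSet _)
            fun k _ => (finite_Ico _ _).subset inter_subset_right)
      _ ≤ ∑ k ∈ Finset.Icc (-(r : ℤ)) r, ({ℓ | ℓ + k ∈ S} ∩ Ico (-(n : ℤ)) n).ncard :=
          Finset.set_ncard_biUnion_le _ _
      _ ≤ ∑ k ∈ Finset.Icc (-(r : ℤ)) r, (2 * n / N + 1) := by
          refine Finset.sum_le_sum fun k _ => ncard_inter_Ico_le hN (fun ℓ hℓ i h0 h1 h => ?_) n
          refine hS (ℓ + k) hℓ i h0 h1 ?_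
          rwa [mem_ofPred_eq, add_right_comm] at h
      _ = (2 * r + 1) * (2 * n / N + 1) := by
          rw [Finset.sum_const, Int.card_Icc, smul_eq_mul]
          congr 1
          omega
  have hN0 : (0 : ℝ) < N := by exact_mod_cast hN
  have hNn : (N : ℝ) ≤ n := by exact_mod_cast hn
  have hn0 : (0 : ℝ) < n := hN0.trans_le hNn
  rw [div_le_div_iff₀ (by positivity) hN0]
  have hdiv : ((2 * n / N : ℕ) : ℝ) * N ≤ 2 * n := by
    exact_mod_cast Nat.div_mul_le_self (2 * n) N
  have hcard' : ((J ∩ Ico (-(n : ℤ)) n).ncard : ℝ) ≤ (2 * r + 1) * ((2 * n / N : ℕ) + 1) := by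
    exact_mod_cast hcard
  calc ((J ∩ Ico (-(n : ℤ)) n).ncard : ℝ) * N
      ≤ (2 * r + 1) * ((2 * n / N : ℕ) + 1) * N := by gcongr
    _ = (2 * r + 1) * (((2 * n / N : ℕ) : ℝ) * N + N) := by ring
    -- For `n ≥ N` the boundary term `N` is at most `2 * n`; this is where the factor 2 in the bound
    -- is lost.
    _ ≤ (2 * r + 1) * (2 * n + 2 * n) := by gcongr; linarith
    _ = 2 * (2 * r + 1) * (2 * n) := by ring

/-- A set that meets every interval of length `L` has upper density bounded below. -/
theorem le_upperDensity_of_syndetic {J : Set ℤ} {L : ℕ} (hL : 0 < L)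
    (hJ : ∀ ℓ : ℤ, ∃ j ∈ J, ℓ ≤ j ∧ j < ℓ + L) : 1 / (2 * (L : ℝ)) ≤ upperDensity J := by
  choose d hdJ hd1 hd2 using hJ
  refine le_limsup_of_frequently_le ?_ ⟨1, ?_⟩
  swap
  · exact eventually_map.2 (Eventually.of_forall fun n => density_ratio_le_one J n)
  refine Eventually.frequently ?_
  filter_upwards [eventually_ge_atTop L] with n hn
  have hcard : 2 * n / L ≤ (J ∩ Ico (-(n : ℤ)) n).ncard := by
    have hinj : InjOn (fun i : ℕ => d (-n + i * L)) (Iio (2 * n / L)) := by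
      have aux : ∀ a b : ℕ, d (-n + a * L) = d (-n + b * L) → ¬ a < b := by
        intro a b hab hlt
        have h1 := hd2 (-n + a * L)
        have h2 := hd1 (-n + b * L)
        have h3 : ((a : ℤ) + 1) * L ≤ b * L := by gcongr; omega
        rw [hab] at h1
        linarith
      intro a _ b _ hab
      exact le_antisymm (not_lt.1 (aux b a hab.symm)) (not_lt.1 (aux a b hab))
    have himg : (fun i : ℕ => d (-n + i * L)) '' Iio (2 * n / L) ⊆ J ∩ Ico (-(n : ℤ)) n := by
      rintro _ ⟨i, hi, rfl⟩
      refine ⟨hdJ _, ?_, ?_⟩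
      · refine le_trans ?_ (hd1 _)
        have : (0 : ℤ) ≤ i * L := by positivity
        linarith
      · have h1 := hd2 (-n + i * L)
        have h2 : (i + 1) * L ≤ 2 * n := (Nat.mul_le_mul_right L hi).trans (Nat.div_mul_le_self _ _)
        have h3 : ((i : ℤ) + 1) * L ≤ 2 * n := by exact_mod_cast h2
        simp only
        linarith
    have := ncard_le_ncard himg ((finite_Ico _ _).subset inter_subset_right)
    rwa [hinj.ncard_image, ← Finset.coe_Iio, ncard_coe_finset, Nat.card_Iio] at this
  have hL0 : (0 : ℝ) < L := by exact_mod_cast hL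
  have hn0 : (0 : ℝ) < n := hL0.trans_le (by exact_mod_cast hn)
  rw [div_le_div_iff₀ (by positivity) (by positivity)]
  -- As `n ≥ L`, the incomplete last block costs less than `n`, so complete blocks cover at least
  -- half of `[-n, n)`.
  have h2 : n ≤ 2 * n / L * L := by
    have e := Nat.div_add_mod' (2 * n) L
    have := Nat.mod_lt (2 * n) hL
    omega
  have h3 : n ≤ (J ∩ Ico (-(n : ℤ)) n).ncard * L := h2.trans (Nat.mul_le_mul_right L hcard)
  have h4 : (n : ℝ) ≤ (J ∩ Ico (-(n : ℤ)) n).ncard * L := by exact_mod_cast h3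
  linarith

/-! ### The Cantor distance -/

theorem eq_of_cantorDist_lt {𝒜 : Type*} {p q : ℤ → 𝒜} {n : ℕ}
    (h : cantorDist p q < (1 / 2 : ℝ) ^ n) {ℓ : ℤ} (hℓ : ℓ.natAbs ≤ n) : p ℓ = q ℓ := by
  by_contra hne
  have hpq : p ≠ q := fun e => hne (congrFun e ℓ)
  rw [cantorDist, if_neg hpq] at h
  have h1 : n < sInf {n : ℕ | ∃ ℓ : ℤ, ℓ.natAbs = n ∧ p ℓ ≠ q ℓ} :=
    (pow_lt_pow_iff_right_of_lt_one₀ (by norm_num) (by norm_num)).1 h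
  exact absurd (Nat.sInf_le (s := {n : ℕ | ∃ ℓ : ℤ, ℓ.natAbs = n ∧ p ℓ ≠ q ℓ}) ⟨ℓ, rfl, hne⟩)
    (by omega)

theorem cantorDist_le_of_eq {𝒜 : Type*} {p q : ℤ → 𝒜} {n : ℕ}
    (h : ∀ ℓ : ℤ, ℓ.natAbs ≤ n → p ℓ = q ℓ) : cantorDist p q ≤ (1 / 2 : ℝ) ^ n := by
  rw [cantorDist]
  split_ifs with hpq
  · positivity
  · obtain ⟨ℓ, hℓ⟩ := Function.ne_iff.1 hpq
    refine pow_le_pow_of_le_one (by norm_num) (by norm_num) (le_csInf ⟨_, ℓ, rfl, hℓ⟩ ?_)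
    rintro _ ⟨m, rfl, hm⟩
    by_contra! hlt
    exact hm (h m hlt.le)

/-! ### Block codings of partitions -/

section Codings

variable {𝒜 ℬ : Type*} {K : ℕ}

instance isProbabilityMeasure_unitAddCircle :
    IsProbabilityMeasure (volume : Measure UnitAddCircle) :=
  ⟨UnitAddCircle.measure_univ⟩

theorem volume_preimage_rot (τ : ℤ →+ Torus K) (ℓ : ℤ) (S : Set (Torus K)) :
    volume (rot τ ℓ ⁻¹' S) = volume S :=
  measure_preimage_add_right volume (τ ℓ) S

theorem continuous_rot (τ : ℤ →+ Torus K) (ℓ : ℤ) : Continuous (rot τ ℓ) :=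
  continuous_id.add continuous_const

theorem rot_rot (τ : ℤ →+ Torus K) (k ℓ : ℤ) (t : Torus K) :
    rot τ k (rot τ ℓ t) = rot τ (ℓ + k) t := by
  simp only [rot, map_add, add_assoc]

theorem rot_zero (τ : ℤ →+ Torus K) (t : Torus K) : rot τ 0 t = t := by simp [rot]

theorem image_rot_neg (τ : ℤ →+ Torus K) (b : ℤ) (S : Set (Torus K)) :
    rot τ (-b) '' S = rot τ b ⁻¹' S := by
  refine congrFun (image_eq_preimage_of_inverse (fun t => ?_) fun t => ?_) S <;>
    simp [rot_rot, rot_zero]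

theorem volume_eq_one_iff {S : Set (Torus K)} (hS : MeasurableSet S) :
    volume S = 1 ↔ ∀ᵐ t, t ∈ S :=
  (mem_ae_iff_prob_eq_one hS).symm

/-- The partition induced from `P` by a local rule `ψ : 𝒜^B → ℬ`. -/
def codePartition (τ : ℤ →+ Torus K) (B : Finset ℤ) (ψ : (B → 𝒜) → ℬ) (P : 𝒜 → Set (Torus K)) :
    ℬ → Set (Torus K) :=
  fun a => ⋃ c ∈ {c : B → 𝒜 | ψ c = a}, ⋂ b : B, rot τ b ⁻¹' P (c b)

/-- Trading images under inverse rotations for preimages lets openness and measurability follow from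
continuity. -/
theorem inducedMap_eq_codePartition (τ : ℤ →+ Torus K) (B : Finset ℤ) (φ : (B → 𝒜) → 𝒜)
    (P : 𝒜 → Set (Torus K)) : inducedMap τ B φ P = codePartition τ B φ P := by
  funext a
  simp only [inducedMap, codePartition, image_rot_neg]

theorem mem_codePartition {τ : ℤ →+ Torus K} {B : Finset ℤ} {ψ : (B → 𝒜) → ℬ}
    {P : 𝒜 → Set (Torus K)} {a : ℬ} {t : Torus K} :
    t ∈ codePartition τ B ψ P a ↔ ∃ c : B → 𝒜, ψ c = a ∧ ∀ b : B, rot τ b t ∈ P (c b) := by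
  simp [codePartition]

theorem iUnion_codePartition (τ : ℤ →+ Torus K) (B : Finset ℤ) (ψ : (B → 𝒜) → ℬ)
    (P : 𝒜 → Set (Torus K)) :
    ⋃ a, codePartition τ B ψ P a = ⋂ b : B, rot τ b ⁻¹' ⋃ a, P a := by
  ext t
  simp only [mem_iUnion, mem_codePartition, mem_iInter, mem_preimage]
  constructor
  · rintro ⟨_, c, -, h⟩ b
    exact ⟨_, h b⟩
  · intro h
    choose c hc using h
    exact ⟨_, c, rfl, hc⟩

theorem pairwise_disjoint_codePartition (τ : ℤ →+ Torus K) (B : Finset ℤ) (ψ : (B → 𝒜) → ℬ)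
    {P : 𝒜 → Set (Torus K)} (hP : Pairwise fun a b => Disjoint (P a) (P b)) :
    Pairwise fun a b => Disjoint (codePartition τ B ψ P a) (codePartition τ B ψ P b) := by
  refine fun a a' hne => Set.disjoint_left.2 fun t h h' => hne ?_
  obtain ⟨c, rfl, hc⟩ := mem_codePartition.1 h
  obtain ⟨c', rfl, hc'⟩ := mem_codePartition.1 h'
  congr 1
  funext b
  by_contra hcc
  exact Set.disjoint_left.1 (hP hcc) (hc b) (hc' b)

theorem ae_mem_iUnion {P : 𝒜 → Set (Torus K)} [Countable 𝒜] (hP : P ∈ measPartitions 𝒜 K) :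
    ∀ᵐ t, t ∈ ⋃ a, P a :=
  (volume_eq_one_iff (MeasurableSet.iUnion hP.1)).1 hP.2.2

theorem ae_rot {τ : ℤ →+ Torus K} {p : Torus K → Prop} (hp : ∀ᵐ t, p t) (ℓ : ℤ) :
    ∀ᵐ t, p (rot τ ℓ t) := by
  rw [ae_iff] at hp ⊢
  exact (volume_preimage_rot τ ℓ {t | ¬ p t}).trans hp

theorem openPartitions_subset [Countable 𝒜] : openPartitions 𝒜 K ⊆ measPartitions 𝒜 K :=
  fun _ hP => ⟨fun a => (hP.1 a).measurableSet, hP.2.1, hP.2.2.2⟩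

/-- Density of the union is automatic: Haar measure charges every nonempty open set. -/
theorem mem_openPartitions_of_isOpen [Countable 𝒜] {P : 𝒜 → Set (Torus K)}
    (hP : P ∈ measPartitions 𝒜 K) (ho : ∀ a, IsOpen (P a)) : P ∈ openPartitions 𝒜 K :=
  ⟨ho, hP.2.1, Measure.dense_of_ae (ae_mem_iUnion hP), hP.2.2⟩

theorem codePartition_mem_measPartitions [Finite 𝒜] [Countable ℬ] (τ : ℤ →+ Torus K)
    (B : Finset ℤ) (ψ : (B → 𝒜) → ℬ) {P : 𝒜 → Set (Torus K)} (hP : P ∈ measPartitions 𝒜 K) :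
    codePartition τ B ψ P ∈ measPartitions ℬ K := by
  have hm : ∀ a, MeasurableSet (codePartition τ B ψ P a) := fun a =>
    MeasurableSet.biUnion (to_countable _) fun c _ =>
      MeasurableSet.iInter fun b => (continuous_rot τ b).measurable (hP.1 _)
  refine ⟨hm, pairwise_disjoint_codePartition τ B ψ hP.2.1, ?_⟩
  rw [volume_eq_one_iff (MeasurableSet.iUnion hm), iUnion_codePartition]
  simp only [mem_iInter, mem_preimage]
  exact ae_all_iff.2 fun b => ae_rot (ae_mem_iUnion hP) b

theorem codePartition_mem_openPartitions [Finite 𝒜] [Countable ℬ] (τ : ℤ →+ Torus K)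
    (B : Finset ℤ) (ψ : (B → 𝒜) → ℬ) {P : 𝒜 → Set (Torus K)} (hP : P ∈ openPartitions 𝒜 K) :
    codePartition τ B ψ P ∈ openPartitions ℬ K :=
  mem_openPartitions_of_isOpen
    (codePartition_mem_measPartitions τ B ψ (openPartitions_subset hP)) fun _ =>
      isOpen_biUnion fun _ _ => isOpen_iInter_of_finite fun b =>
        (hP.1 _).preimage (continuous_rot τ b)

/-- `p` is the trajectory of `t` through the partition `P`. -/
def IsTrajectory (τ : ℤ →+ Torus K) (P : 𝒜 → Set (Torus K)) (t : Torus K) (p : ℤ → 𝒜) : Prop :=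
  ∀ ℓ : ℤ, rot τ ℓ t ∈ P (p ℓ)

theorem IsTrajectory.code {τ : ℤ →+ Torus K} {P : 𝒜 → Set (Torus K)} {t : Torus K} {p : ℤ → 𝒜}
    (h : IsTrajectory τ P t p) (B : Finset ℤ) (ψ : (B → 𝒜) → ℬ) :
    IsTrajectory τ (codePartition τ B ψ P) t fun ℓ => ψ fun b => p (ℓ + b) := fun ℓ =>
  mem_codePartition.2 ⟨_, rfl, fun b => by rw [rot_rot]; exact h _⟩

theorem IsTrajectory.induced {τ : ℤ →+ Torus K} {P : 𝒜 → Set (Torus K)} {t : Torus K}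
    {p : ℤ → 𝒜} (h : IsTrajectory τ P t p) {Φ : (ℤ → 𝒜) → (ℤ → 𝒜)} {B : Finset ℤ}
    {φ : (B → 𝒜) → 𝒜} (hφ : IsLocalMap Φ B φ) :
    IsTrajectory τ (inducedMap τ B φ P) t (Φ p) := by
  rw [inducedMap_eq_codePartition, show Φ p = fun ℓ => φ fun b => p (ℓ + b) from funext (hφ p)]
  exact h.code B φ

theorem mem_iff_of_mem {P : 𝒜 → Set (Torus K)} (hP : Pairwise fun a b => Disjoint (P a) (P b))
    {t : Torus K} {a : 𝒜} (h : t ∈ P a) (b : 𝒜) : t ∈ P b ↔ b = a := by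
  refine ⟨fun hb => ?_, fun e => e ▸ h⟩
  by_contra hne
  exact Set.disjoint_left.1 (hP hne) hb h

theorem ae_exists_trajectory [Countable 𝒜] (τ : ℤ →+ Torus K) {P : 𝒜 → Set (Torus K)}
    (hP : P ∈ measPartitions 𝒜 K) : ∀ᵐ t, ∃ p, IsTrajectory τ P t p := by
  filter_upwards [ae_all_iff.2 fun ℓ : ℤ => ae_rot (τ := τ) (ae_mem_iUnion hP) ℓ] with t ht
  simp only [mem_iUnion] at ht
  choose p hp using ht
  exact ⟨p, hp⟩

theorem inducedMap_image_measPartitions_subset [Finite 𝒜] (τ : ℤ →+ Torus K) (B : Finset ℤ)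
    (φ : (B → 𝒜) → 𝒜) : inducedMap τ B φ '' measPartitions 𝒜 K ⊆ measPartitions 𝒜 K := by
  rintro _ ⟨P, hP, rfl⟩
  rw [inducedMap_eq_codePartition]
  exact codePartition_mem_measPartitions τ B φ hP

theorem inducedMap_image_openPartitions_subset [Finite 𝒜] (τ : ℤ →+ Torus K) (B : Finset ℤ)
    (φ : (B → 𝒜) → 𝒜) : inducedMap τ B φ '' openPartitions 𝒜 K ⊆ openPartitions 𝒜 K := by
  rintro _ ⟨P, hP, rfl⟩
  rw [inducedMap_eq_codePartition]
  exact codePartition_mem_openPartitions τ B φ hP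

theorem image_quasisturmian_subset [Finite 𝒜] (τ : ℤ →+ Torus K) {Φ : (ℤ → 𝒜) → (ℤ → 𝒜)}
    {B : Finset ℤ} {φ : (B → 𝒜) → 𝒜} (hφ : IsLocalMap Φ B φ) :
    Φ '' quasisturmian 𝒜 τ ⊆ quasisturmian 𝒜 τ := by
  rintro _ ⟨p, ⟨P, hP, t, ht⟩, rfl⟩
  exact ⟨_, inducedMap_image_openPartitions_subset τ B φ ⟨P, hP, rfl⟩, t,
    IsTrajectory.induced ht hφ⟩

end Codings

/-! ### Small open sets with generic boundary -/

section Markers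

variable {K : ℕ}

/-- By compactness finitely many translates of `V` cover the torus, with times in `[-r, r]`.
Starting from `rot τ (-r) t` moves these times into `[-2r, 0]`, so the visit lies in the past. -/
theorem exists_finite_recurrence {τ : ℤ →+ Torus K} (hdense : DenseRange τ) {V : Set (Torus K)}
    (hV : IsOpen V) (hne : V.Nonempty) :
    ∃ M : ℕ, ∀ t : Torus K, ∃ i : ℕ, i ≤ M ∧ rot τ (-(i : ℤ)) t ∈ V := by
  obtain ⟨s, hs⟩ := isCompact_univ.elim_finite_subcover (fun n : ℤ => rot τ n ⁻¹' V)
    (fun n => hV.preimage (continuous_rot τ n)) fun t _ => by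
      obtain ⟨n, hn⟩ := hdense.exists_mem_open (hV.preimage (continuous_const_add t))
        (by obtain ⟨v, hv⟩ := hne; exact ⟨-t + v, by simpa using hv⟩)
      exact mem_iUnion.2 ⟨n, hn⟩
  obtain ⟨r, hr⟩ := exists_finset_int_bound s
  refine ⟨2 * r, fun t => ?_⟩
  obtain ⟨n, hn, ht⟩ := mem_iUnion₂.1 (hs (mem_univ (rot τ (-(r : ℤ)) t)))
  have := hr n hn
  rw [mem_preimage, rot_rot] at ht
  refine ⟨(r - n).toNat, by omega, ?_⟩
  rwa [show -((r - n).toNat : ℤ) = -r + n by omega]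

/-- There are small balls around `0` whose boundary is null and avoids a given countable set, and
whose first `N` translates are pairwise disjoint. -/
theorem exists_marker {τ : ℤ →+ Torus K} (hτ : Function.Injective τ) (N : ℕ) {D : Set (Torus K)}
    (hD : D.Countable) :
    ∃ V : Set (Torus K), IsOpen V ∧ (0 : Torus K) ∈ V ∧ volume (frontier V) = 0 ∧
      (∀ t ∈ D, t ∉ frontier V) ∧
      ∀ t ∈ V, ∀ i : ℕ, 0 < i → i < N → rot τ i t ∉ V := by
  -- A ball of radius below `δ / 2` cannot contain both `t` and `t + τ i` for `0 < i < N`.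
  obtain ⟨δ, hδ, hδ'⟩ : ∃ δ : ℝ, 0 < δ ∧ ∀ i ∈ Finset.Ioo 0 N, δ ≤ dist (τ (i : ℤ)) 0 := by
    rcases (Finset.Ioo 0 N).eq_empty_or_nonempty with he | hne
    · exact ⟨1, one_pos, by simp [he]⟩
    · obtain ⟨i, hi, hmin⟩ := Finset.exists_min_image _ (fun i : ℕ => dist (τ (i : ℤ)) 0) hne
      refine ⟨_, dist_pos.2 fun h => ?_, hmin⟩
      have : (i : ℤ) = 0 := hτ (h.trans (map_zero τ).symm)
      have := (Finset.mem_Ioo.1 hi).1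
      omega
  -- Concentric spheres are disjoint, so only countably many radii give positive measure; the points
  -- of `D` exclude only countably many more.
  have hc : {r : ℝ | 0 < volume (Metric.sphere (0 : Torus K) r)}.Countable :=
    Measure.countable_meas_pos_of_disjoint_iUnion
      (fun r => Metric.isClosed_sphere.measurableSet)
      fun r r' hne => Set.disjoint_left.2 fun t h h' => hne (h.symm.trans h')
  have hc' := hc.union (hD.image fun t => dist t 0)
  obtain ⟨r, hr, hr0, hr1⟩ := (hc'.dense_compl ℝ).exists_between (half_pos hδ)
  simp only [mem_compl_iff, mem_union, not_or, mem_ofPred_eq, not_lt, mem_image, not_exists,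
    not_and] at hr
  have hfr := Metric.frontier_ball_subset_sphere (x := (0 : Torus K)) (ε := r)
  refine ⟨Metric.ball 0 r, Metric.isOpen_ball, Metric.mem_ball_self hr0,
    measure_mono_null hfr (nonpos_iff_eq_zero.1 hr.1), fun t ht h => hr.2 t ht (hfr h),
    fun t ht i h0 hi h => ?_⟩
  have h1 := hδ' i (Finset.mem_Ioo.2 ⟨h0, hi⟩)
  have h2 : dist (τ (i : ℤ)) 0 = dist (rot τ i t) t := by
    simp [rot, dist_eq_norm]
  have h3 := dist_triangle_right (rot τ i t) t 0
  rw [Metric.mem_ball] at ht h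
  linarith

/-- The two-cell partition given by an open set and its exterior. -/
def markerPartition (V : Set (Torus K)) : Bool → Set (Torus K) :=
  fun i => bif i then V else (closure V)ᶜ

theorem mem_markerPartition {V : Set (Torus K)} {t : Torus K} {i : Bool}
    (h : t ∈ markerPartition V i) : t ∈ V ↔ i = true := by
  cases i
  · simpa using fun hv => h (subset_closure hv)
  · exact iff_of_true h rfl

theorem exists_mem_markerPartition {V : Set (Torus K)} {t : Torus K}
    (ht : t ∉ frontier V) : ∃ i, t ∈ markerPartition V i := by
  by_cases h : t ∈ V
  · exact ⟨true, h⟩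
  · exact ⟨false, fun hc => ht ⟨hc, fun hi => h (interior_subset hi)⟩⟩

theorem isOpen_markerPartition {V : Set (Torus K)} (hV : IsOpen V) (i : Bool) :
    IsOpen (markerPartition V i) := by
  cases i
  · exact isClosed_closure.isOpen_compl
  · exact hV

variable {𝒜 : Type*}

/-- The common refinement of a partition and a marker partition. -/
def markedPartition (P : 𝒜 → Set (Torus K)) (V : Set (Torus K)) : 𝒜 × Bool → Set (Torus K) :=
  fun x => P x.1 ∩ markerPartition V x.2

theorem markedPartition_mem_measPartitions [Countable 𝒜] {P : 𝒜 → Set (Torus K)}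
    (hP : P ∈ measPartitions 𝒜 K) {V : Set (Torus K)} (hV : IsOpen V)
    (hfr : volume (frontier V) = 0) : markedPartition P V ∈ measPartitions (𝒜 × Bool) K := by
  have hm : ∀ x, MeasurableSet (markedPartition P V x) := fun x =>
    (hP.1 _).inter (isOpen_markerPartition hV _).measurableSet
  refine ⟨hm, ?_, ?_⟩
  · rintro ⟨a, i⟩ ⟨b, j⟩ hne
    refine Set.disjoint_left.2 fun t h h' => hne ?_
    have e1 : a = b := (mem_iff_of_mem hP.2.1 h'.1 a).1 h.1
    have e2 := (mem_markerPartition h.2).symm.trans (mem_markerPartition h'.2)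
    exact Prod.ext e1 (Bool.eq_iff_iff.2 e2)
  · rw [volume_eq_one_iff (MeasurableSet.iUnion hm)]
    have hfr' : ∀ᵐ t, t ∉ frontier V := measure_eq_zero_iff_ae_notMem.1 hfr
    filter_upwards [ae_mem_iUnion hP, hfr'] with t ht ht'
    obtain ⟨a, ha⟩ := mem_iUnion.1 ht
    obtain ⟨i, hi⟩ := exists_mem_markerPartition ht'
    exact mem_iUnion.2 ⟨(a, i), ha, hi⟩

theorem markedPartition_mem_openPartitions [Countable 𝒜] {P : 𝒜 → Set (Torus K)}
    (hP : P ∈ openPartitions 𝒜 K) {V : Set (Torus K)} (hV : IsOpen V)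
    (hfr : volume (frontier V) = 0) : markedPartition P V ∈ openPartitions (𝒜 × Bool) K :=
  mem_openPartitions_of_isOpen
    (markedPartition_mem_measPartitions (openPartitions_subset hP) hV hfr) fun _ =>
      (hP.1 _).inter (isOpen_markerPartition hV _)

theorem exists_marked_trajectory {τ : ℤ →+ Torus K} {P : 𝒜 → Set (Torus K)} {V : Set (Torus K)}
    {t : Torus K} {p : ℤ → 𝒜} (hp : IsTrajectory τ P t p)
    (ht : ∀ ℓ, rot τ ℓ t ∉ frontier V) :
    ∃ ρ, IsTrajectory τ (markedPartition P V) t ρ ∧ ∀ ℓ, (ρ ℓ).1 = p ℓ := by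
  choose i hi using fun ℓ => exists_mem_markerPartition (ht ℓ)
  exact ⟨fun ℓ => (p ℓ, i ℓ), fun ℓ => ⟨hp ℓ, hi ℓ⟩, fun _ => rfl⟩

theorem markerPartition_mem_openPartitions {V : Set (Torus K)} (hV : IsOpen V)
    (hfr : volume (frontier V) = 0) : markerPartition V ∈ openPartitions Bool K := by
  refine mem_openPartitions_of_isOpen ⟨fun i => (isOpen_markerPartition hV i).measurableSet,
    fun i j hne => Set.disjoint_left.2 fun t h h' => hne ?_, ?_⟩ (isOpen_markerPartition hV)
  · exact Bool.eq_iff_iff.2 ((mem_markerPartition h).symm.trans (mem_markerPartition h'))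
  · rw [volume_eq_one_iff
      (MeasurableSet.iUnion fun i => (isOpen_markerPartition hV i).measurableSet)]
    have hfr' : ∀ᵐ t, t ∉ frontier V := measure_eq_zero_iff_ae_notMem.1 hfr
    filter_upwards [hfr'] with t ht
    exact mem_iUnion.2 (exists_mem_markerPartition ht)

/-- Every finite word is read along the orbit of `0` through some open partition. -/
theorem exists_openPartition_word [Finite 𝒜] {τ : ℤ →+ Torus K} (hτ : Function.Injective τ)
    (w : ℤ → 𝒜) (M : ℕ) : ∃ P ∈ openPartitions 𝒜 K, ∃ p, IsTrajectory τ P 0 p ∧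
      ∀ ℓ : ℤ, ℓ.natAbs ≤ M → p ℓ = w ℓ := by
  classical
  obtain ⟨V, hV, h0, hfr, hD, hsep⟩ := exists_marker hτ (2 * M + 1)
    (countable_range fun ℓ : ℤ => rot τ ℓ 0)
  choose β hβ using fun ℓ : ℤ => exists_mem_markerPartition (hD _ ⟨ℓ, rfl⟩)
  have hβV : ∀ ℓ, rot τ ℓ 0 ∈ V ↔ β ℓ = true := fun ℓ => mem_markerPartition (hβ ℓ)
  have hβ0 : β 0 = true := (hβV 0).1 (by rwa [rot_zero])
  -- The range `2 * M` is needed because a window of radius `M` is later centred at any `ℓ` with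
  -- `|ℓ| ≤ M`.
  have hβM : ∀ ℓ : ℤ, ℓ.natAbs ≤ 2 * M → β ℓ = true → ℓ = 0 := by
    intro ℓ hℓ hb
    rw [← hβV] at hb
    by_contra hne
    rcases lt_or_gt_of_ne hne with h | h
    · have := hsep _ hb ℓ.natAbs (by omega) (by omega)
      rw [rot_rot, show ℓ + (ℓ.natAbs : ℤ) = 0 by omega, rot_zero] at this
      exact this h0
    · have := hsep _ h0 ℓ.natAbs (by omega) (by omega)
      rw [show (ℓ.natAbs : ℤ) = ℓ by omega] at this
      exact this hb
  let W : Finset ℤ := Finset.Icc (-(M : ℤ)) M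
  -- For `|ℓ| ≤ M` the only mark in the window at `ℓ` has offset `-ℓ`, so the code learns the
  -- position `ℓ`; `w 0` is a mere default.
  let ψ : (W → Bool) → 𝒜 := fun c => if h : ∃ j : W, c j = true then w (-(h.choose : ℤ)) else w 0
  refine ⟨_, codePartition_mem_openPartitions τ W ψ (markerPartition_mem_openPartitions hV hfr), _,
    IsTrajectory.code (p := β) hβ W ψ, fun ℓ hℓ => ?_⟩
  have hex : ∃ j : W, β (ℓ + j) = true :=
    ⟨⟨-ℓ, Finset.mem_Icc.2 (by omega)⟩, by simpa using hβ0⟩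
  have hspec := hex.choose_spec
  have hmem := Finset.mem_Icc.1 hex.choose.2
  have := hβM _ (by omega) hspec
  simp only [ψ, dif_pos hex]
  congr 1
  omega

/-- Translates of a marker have small measure. -/
theorem volume_marker_le {τ : ℤ →+ Torus K} {V : Set (Torus K)} (hV : IsOpen V) {N : ℕ}
    (hN : 0 < N) (hsep : ∀ t ∈ V, ∀ i : ℕ, 0 < i → i < N → rot τ i t ∉ V) :
    volume.real V ≤ 1 / N := by
  have hdisj : PairwiseDisjoint ((Finset.range N : Finset ℕ) : Set ℕ) fun i : ℕ => rot τ i ⁻¹' V := by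
    have aux : ∀ i j : ℕ, i < j → j < N → Disjoint (rot τ i ⁻¹' V) (rot τ j ⁻¹' V) := by
      refine fun i j hij hj => Set.disjoint_left.2 fun t hi h => ?_
      have := hsep _ hi (j - i) (by omega) (by omega)
      rw [rot_rot, show (i : ℤ) + ((j - i : ℕ) : ℤ) = j by omega] at this
      exact this h
    intro i hi j hj hne
    simp only [Finset.coe_range, mem_Iio] at hi hj
    rcases lt_or_gt_of_ne hne with h | h
    · exact aux i j h hj
    · exact (aux j i h hi).symm
  have hsum := measureReal_biUnion_finset (μ := (volume : Measure (Torus K))) hdisj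
    fun i _ => (hV.preimage (continuous_rot τ i)).measurableSet
  simp only [measureReal_def, volume_preimage_rot, Finset.sum_const, Finset.card_range,
    nsmul_eq_mul] at hsum
  have hle : volume.real (⋃ i ∈ Finset.range N, rot τ (i : ℤ) ⁻¹' V) ≤ 1 := measureReal_le_one
  rw [measureReal_def, hsum] at hle
  rw [le_div_iff₀ (by exact_mod_cast hN), mul_comm]
  exact hle

end Markers

variable {𝒜 : Type*} {K : ℕ}

/-! ### Surjective automata have dense image on partitions and quasisturmian sequences -/

/-- If `Φ` is onto, a block code of the marked partition is a `Φ`-preimage of the trajectory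
outside the `r`-neighbourhood of the visits to the marker. -/
theorem exists_coding_of_surjective {τ : ℤ →+ Torus K} (hdense : DenseRange τ)
    {Φ : (ℤ → 𝒜) → (ℤ → 𝒜)} {B : Finset ℤ} {φ : (B → 𝒜) → 𝒜} (hφ : IsLocalMap Φ B φ)
    (hsurj : Function.Surjective Φ) (a₀ : 𝒜) {r : ℕ} (hr : ∀ b ∈ B, b.natAbs ≤ r)
    {V : Set (Torus K)} (hV : IsOpen V) (hne : V.Nonempty) :
    ∃ (W : Finset ℤ) (ψ : (W → 𝒜 × Bool) → 𝒜), ∀ (P : 𝒜 → Set (Torus K)) (t : Torus K)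
      (ρ : ℤ → 𝒜 × Bool), IsTrajectory τ (markedPartition P V) t ρ → ∀ ℓ : ℤ,
        (∀ k : ℤ, k.natAbs ≤ r → rot τ (ℓ + k) t ∉ V) →
          Φ (fun ℓ => ψ fun b => ρ (ℓ + b)) ℓ = (ρ ℓ).1 := by
  classical
  obtain ⟨M, hM⟩ := exists_finite_recurrence hdense hV hne
  obtain ⟨s, hs⟩ := hsurj.hasRightInverse
  let W : Finset ℤ := Finset.Icc (-(M : ℤ)) M
  -- The filler outside `W` does not affect the codes of actual trajectories: recurrence puts a mark
  -- in the window, and `cutLift_congr` applies.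
  refine ⟨W, fun c => cutLift s a₀ M (fun j => if h : j ∈ W then c ⟨j, h⟩ else (a₀, true)) 0,
    fun P t ρ hρ ℓ hℓ => ?_⟩
  have hmark : ∀ j, rot τ j t ∈ V ↔ (ρ j).2 = true := fun j => mem_markerPartition (hρ j).2
  have hrec : ∀ ℓ : ℤ, ∃ i : ℕ, i ≤ M ∧ (ρ (ℓ - i)).2 = true := fun ℓ => by
    obtain ⟨i, hi, h⟩ := hM (rot τ ℓ t)
    rw [rot_rot, ← sub_eq_add_neg, hmark] at h
    exact ⟨i, hi, h⟩
  have hcut : (fun ℓ : ℤ => cutLift s a₀ M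
      (fun j => if _ : j ∈ W then ρ (ℓ + j) else (a₀, true)) 0) = cutLift s a₀ M ρ := by
    funext ℓ
    refine (cutLift_congr s a₀ (hrec ℓ) fun j h1 h2 => ?_).symm
    rw [zero_add, dif_pos (Finset.mem_Icc.2 ⟨h1, h2⟩)]
  refine (congrFun (congrArg Φ hcut) ℓ).trans (apply_cutLift hφ hs a₀ hr (hrec ℓ) fun k hk => ?_)
  exact Bool.eq_false_iff.2 fun h => hℓ k hk ((hmark _).2 h)

/-- Up to a null set, the cells can differ only at points that visit `V` at a time in `[-r, r]`. The
code depends on neither measurability nor openness of `P`, so one estimate serves both kinds of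
partition. -/
theorem exists_symmDiffDist_lt [Fintype 𝒜] {τ : ℤ →+ Torus K} (hτ : Function.Injective τ)
    (hdense : DenseRange τ) {Φ : (ℤ → 𝒜) → (ℤ → 𝒜)} {B : Finset ℤ} {φ : (B → 𝒜) → 𝒜}
    (hφ : IsLocalMap Φ B φ) (hsurj : Function.Surjective Φ) (a₀ : 𝒜) {P : 𝒜 → Set (Torus K)}
    (hP : P ∈ measPartitions 𝒜 K) {ε : ℝ} (hε : 0 < ε) :
    ∃ V : Set (Torus K), IsOpen V ∧ volume (frontier V) = 0 ∧
      ∃ (W : Finset ℤ) (ψ : (W → 𝒜 × Bool) → 𝒜),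
        symmDiffDist P (inducedMap τ B φ (codePartition τ W ψ (markedPartition P V))) < ε := by
  obtain ⟨r, hr⟩ := exists_finset_int_bound B
  obtain ⟨N, hN⟩ := exists_nat_gt (Fintype.card 𝒜 * (2 * r + 1) / ε)
  have hN0 : (0 : ℝ) < N := lt_of_le_of_lt (by positivity) hN
  have hN0' : 0 < N := by exact_mod_cast hN0
  obtain ⟨V, hV, h0, hfr, -, hsep⟩ := exists_marker hτ N countable_empty
  obtain ⟨W, ψ, hψ⟩ := exists_coding_of_surjective hdense hφ hsurj a₀ hr hV ⟨0, h0⟩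
  refine ⟨V, hV, hfr, W, ψ, ?_⟩
  have hR := markedPartition_mem_measPartitions hP hV hfr
  have hQ := inducedMap_image_measPartitions_subset τ B φ
    ⟨_, codePartition_mem_measPartitions τ W ψ hR, rfl⟩
  have hbad : volume.real (⋃ k ∈ Finset.Icc (-(r : ℤ)) r, rot τ k ⁻¹' V) ≤ (2 * r + 1) / N := by
    refine (measureReal_biUnion_finset_le _ _).trans ?_
    simp only [measureReal_def, volume_preimage_rot, Finset.sum_const, Int.card_Icc, nsmul_eq_mul]
    rw [show ((r : ℤ) + 1 - -r).toNat = 2 * r + 1 by omega, ← mul_one_div]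
    push_cast
    exact mul_le_mul_of_nonneg_left (volume_marker_le hV hN0' hsep) (by positivity)
  have hcell : ∀ a, volume.real (symmDiff (P a)
      (inducedMap τ B φ (codePartition τ W ψ (markedPartition P V)) a)) ≤ (2 * r + 1) / N := by
    refine fun a => le_trans (ENNReal.toReal_mono (measure_ne_top _ _) (measure_mono_ae ?_)) hbad
    filter_upwards [ae_exists_trajectory τ hR] with t ⟨ρ, hρ⟩ ht
    by_contra hgood
    have hgood' : ∀ k : ℤ, k.natAbs ≤ r → rot τ (0 + k) t ∉ V := fun k hk h =>
      hgood (mem_iUnion₂.2 ⟨k, Finset.mem_Icc.2 (by omega), by rwa [zero_add] at h⟩)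
    have h1 := (hρ 0).1
    have h2 := (hρ.code W ψ).induced hφ 0
    rw [hψ P t ρ hρ 0 hgood'] at h2
    rw [rot_zero] at h1 h2
    have h3 := (mem_iff_of_mem hP.2.1 h1 a).trans (mem_iff_of_mem hQ.2.1 h2 a).symm
    rcases ht with ⟨h, h'⟩ | ⟨h, h'⟩
    · exact h' (h3.1 h)
    · exact h' (h3.2 h)
  calc symmDiffDist P (inducedMap τ B φ (codePartition τ W ψ (markedPartition P V)))
      ≤ ∑ _a : 𝒜, ((2 * r + 1) / N : ℝ) := Finset.sum_le_sum fun a _ => hcell a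
    _ = Fintype.card 𝒜 * (2 * r + 1) / N := by
        rw [Finset.sum_const, Finset.card_univ, nsmul_eq_mul, mul_div_assoc]
    _ < ε := by rwa [div_lt_iff₀ hN0, mul_comm ε, ← div_lt_iff₀ hε]

theorem nonempty_of_mem_measPartitions {P : 𝒜 → Set (Torus K)} (hP : P ∈ measPartitions 𝒜 K) :
    Nonempty 𝒜 := by
  by_contra he
  have := not_nonempty_iff.1 he
  have := hP.2.2
  simp at this

theorem isDenseIn_measPartitions_of_surjective [Fintype 𝒜] {τ : ℤ →+ Torus K}
    (hτ : Function.Injective τ) (hdense : DenseRange τ) {Φ : (ℤ → 𝒜) → (ℤ → 𝒜)} {B : Finset ℤ}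
    {φ : (B → 𝒜) → 𝒜} (hφ : IsLocalMap Φ B φ) (hsurj : Function.Surjective Φ) :
    IsDenseIn symmDiffDist (inducedMap τ B φ '' measPartitions 𝒜 K) (measPartitions 𝒜 K) := by
  refine ⟨inducedMap_image_measPartitions_subset τ B φ, fun P hP ε hε => ?_⟩
  obtain ⟨a₀⟩ := nonempty_of_mem_measPartitions hP
  obtain ⟨V, hV, hfr, W, ψ, h⟩ := exists_symmDiffDist_lt hτ hdense hφ hsurj a₀ hP hε
  exact ⟨_, ⟨_, codePartition_mem_measPartitions τ W ψ
    (markedPartition_mem_measPartitions hP hV hfr), rfl⟩, h⟩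

theorem isDenseIn_openPartitions_of_surjective [Fintype 𝒜] {τ : ℤ →+ Torus K}
    (hτ : Function.Injective τ) (hdense : DenseRange τ) {Φ : (ℤ → 𝒜) → (ℤ → 𝒜)} {B : Finset ℤ}
    {φ : (B → 𝒜) → 𝒜} (hφ : IsLocalMap Φ B φ) (hsurj : Function.Surjective Φ) :
    IsDenseIn symmDiffDist (inducedMap τ B φ '' openPartitions 𝒜 K) (openPartitions 𝒜 K) := by
  refine ⟨inducedMap_image_openPartitions_subset τ B φ, fun P hP ε hε => ?_⟩
  have hP' := openPartitions_subset hP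
  obtain ⟨a₀⟩ := nonempty_of_mem_measPartitions hP'
  obtain ⟨V, hV, hfr, W, ψ, h⟩ := exists_symmDiffDist_lt hτ hdense hφ hsurj a₀ hP' hε
  exact ⟨_, ⟨_, codePartition_mem_openPartitions τ W ψ
    (markedPartition_mem_openPartitions hP hV hfr), rfl⟩, h⟩

theorem isDenseIn_besicovitchDist_of_surjective [Finite 𝒜] {τ : ℤ →+ Torus K}
    (hτ : Function.Injective τ) (hdense : DenseRange τ) {Φ : (ℤ → 𝒜) → (ℤ → 𝒜)} {B : Finset ℤ}
    {φ : (B → 𝒜) → 𝒜} (hφ : IsLocalMap Φ B φ) (hsurj : Function.Surjective Φ) :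
    IsDenseIn besicovitchDist (Φ '' quasisturmian 𝒜 τ) (quasisturmian 𝒜 τ) := by
  refine ⟨image_quasisturmian_subset τ hφ, ?_⟩
  rintro p ⟨P, hP, t, hp⟩ ε hε
  obtain ⟨r, hr⟩ := exists_finset_int_bound B
  obtain ⟨N, hN⟩ := exists_nat_gt (2 * (2 * r + 1) / ε)
  have hN0 : (0 : ℝ) < N := lt_of_le_of_lt (by positivity) hN
  -- The marker boundary must miss this particular orbit, not just almost every one, so that the
  -- marked trajectory exists at all times.
  obtain ⟨V, hV, h0, hfr, hD, hsep⟩ := exists_marker hτ N (countable_range fun ℓ : ℤ => rot τ ℓ t)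
  obtain ⟨W, ψ, hψ⟩ := exists_coding_of_surjective hdense hφ hsurj (p 0) hr hV ⟨0, h0⟩
  obtain ⟨ρ, hρ, hρp⟩ := exists_marked_trajectory (V := V) hp fun ℓ => hD _ ⟨ℓ, rfl⟩
  refine ⟨_, ⟨_, ⟨_, codePartition_mem_openPartitions τ W ψ
    (markedPartition_mem_openPartitions hP hV hfr), t, hρ.code W ψ⟩, rfl⟩, ?_⟩
  refine (upperDensity_le_of_separated (S := {ℓ | rot τ ℓ t ∈ V}) (r := r) (N := N)
    (by exact_mod_cast hN0) (fun ℓ hℓ i hi0 hiN h => ?_) fun ℓ hℓ => ?_).trans_lt ?_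
  · refine hsep _ hℓ i hi0 hiN ?_
    rwa [rot_rot]
  · by_contra! hfar
    exact hℓ ((hρp ℓ).symm.trans (hψ P t ρ hρ ℓ hfar).symm)
  · rwa [div_lt_iff₀ hN0, mul_comm ε, ← div_lt_iff₀ hε]

/-- Quasisturmian sequences realise every finite word. -/
theorem exists_quasisturmian_eq [Finite 𝒜] {τ : ℤ →+ Torus K} (hτ : Function.Injective τ)
    (w : ℤ → 𝒜) (M : ℕ) : ∃ p ∈ quasisturmian 𝒜 τ, ∀ ℓ : ℤ, ℓ.natAbs ≤ M → p ℓ = w ℓ := by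
  obtain ⟨P, hP, p, hp, hw⟩ := exists_openPartition_word hτ w M
  exact ⟨p, ⟨P, hP, 0, hp⟩, hw⟩

theorem isDenseIn_cantorDist_of_surjective [Finite 𝒜] {τ : ℤ →+ Torus K}
    (hτ : Function.Injective τ) {Φ : (ℤ → 𝒜) → (ℤ → 𝒜)} {B : Finset ℤ}
    {φ : (B → 𝒜) → 𝒜} (hφ : IsLocalMap Φ B φ) (hsurj : Function.Surjective Φ) :
    IsDenseIn cantorDist (Φ '' quasisturmian 𝒜 τ) (quasisturmian 𝒜 τ) := by
  refine ⟨image_quasisturmian_subset τ hφ, fun p _ ε hε => ?_⟩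
  obtain ⟨r, hr⟩ := exists_finset_int_bound B
  obtain ⟨n, hn⟩ := exists_pow_lt_of_lt_one hε (by norm_num : (1 / 2 : ℝ) < 1)
  obtain ⟨x, rfl⟩ := hsurj p
  -- The values of `Φ` on `[-n, n]` depend only on cells in `[-(n + r), n + r]`.
  obtain ⟨q, hq, hqx⟩ := exists_quasisturmian_eq hτ x (n + r)
  refine ⟨_, ⟨q, hq, rfl⟩, (cantorDist_le_of_eq fun ℓ hℓ => ?_).trans_lt hn⟩
  rw [hφ, hφ]
  congr 1
  funext b
  have := hr b b.2
  exact (hqx _ (by omega)).symm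

/-! ### Density of the image forces surjectivity -/

theorem surjective_of_isDenseIn_cantorDist [Finite 𝒜] [TopologicalSpace 𝒜] [DiscreteTopology 𝒜]
    {τ : ℤ →+ Torus K} (hτ : Function.Injective τ) {Φ : (ℤ → 𝒜) → (ℤ → 𝒜)} (hΦ : Continuous Φ)
    (h : IsDenseIn cantorDist (Φ '' quasisturmian 𝒜 τ) (quasisturmian 𝒜 τ)) :
    Function.Surjective Φ := by
  by_contra hns
  obtain ⟨M, w, hw⟩ := exists_forbidden_word hΦ hns
  obtain ⟨p, hp, hpw⟩ := exists_quasisturmian_eq hτ w M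
  obtain ⟨_, ⟨q, -, rfl⟩, hd⟩ := h.2 p hp ((1 / 2) ^ M) (by positivity)
  obtain ⟨ℓ, hℓ, hne⟩ := hw q
  have hℓ' : ℓ.natAbs ≤ M := by have := Finset.mem_Icc.1 hℓ; omega
  exact hne ((eq_of_cantorDist_lt hd hℓ').symm.trans (hpw ℓ hℓ'))

/-- The cylinder of points whose trajectory agrees with `w` on `[-M, M]`. -/
def wordCylinder (τ : ℤ →+ Torus K) (P : 𝒜 → Set (Torus K)) (w : ℤ → 𝒜) (M : ℕ) : Set (Torus K) :=
  ⋂ ℓ ∈ Finset.Icc (-(M : ℤ)) M, rot τ ℓ ⁻¹' P (w ℓ)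

theorem exists_openPartition_isOpen_wordCylinder [Finite 𝒜] {τ : ℤ →+ Torus K}
    (hτ : Function.Injective τ) (w : ℤ → 𝒜) (M : ℕ) :
    ∃ P ∈ openPartitions 𝒜 K, IsOpen (wordCylinder τ P w M) ∧ 0 ∈ wordCylinder τ P w M ∧
      ∃ p, IsTrajectory τ P 0 p := by
  obtain ⟨P, hP, p, hp, hw⟩ := exists_openPartition_word hτ w M
  refine ⟨P, hP, isOpen_biInter_finset fun ℓ _ => (hP.1 _).preimage (continuous_rot τ ℓ),
    mem_iInter₂.2 fun ℓ hℓ => ?_, p, hp⟩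
  rw [mem_preimage, ← hw ℓ (by have := Finset.mem_Icc.1 hℓ; omega)]
  exact hp ℓ

/-- Almost every point of the forbidden word's cylinder enters a symmetric difference at one of `2 *
M + 1` times. Hence the cylinder's measure is at most `2 * M + 1` times the distance, which cannot
be arbitrarily small. -/
theorem surjective_of_isDenseIn_symmDiffDist [Fintype 𝒜] [TopologicalSpace 𝒜]
    [DiscreteTopology 𝒜] {τ : ℤ →+ Torus K} (hτ : Function.Injective τ)
    {Φ : (ℤ → 𝒜) → (ℤ → 𝒜)} (hΦ : Continuous Φ) {B : Finset ℤ} {φ : (B → 𝒜) → 𝒜}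
    (hφ : IsLocalMap Φ B φ)
    (h : IsDenseIn symmDiffDist (inducedMap τ B φ '' openPartitions 𝒜 K) (openPartitions 𝒜 K)) :
    Function.Surjective Φ := by
  by_contra hns
  obtain ⟨M, w, hw⟩ := exists_forbidden_word hΦ hns
  obtain ⟨P, hP, hC, h0, -⟩ := exists_openPartition_isOpen_wordCylinder hτ w M
  have hpos : 0 < volume.real (wordCylinder τ P w M) :=
    ENNReal.toReal_pos (hC.measure_pos volume ⟨0, h0⟩).ne' (measure_ne_top _ _)
  obtain ⟨R, hR, hd⟩ := h.2 P hP (volume.real (wordCylinder τ P w M) / (2 * M + 1)) (by positivity)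
  have hR' := h.1 hR
  obtain ⟨Q, hQ, rfl⟩ := hR
  set R := inducedMap τ B φ Q
  rw [lt_div_iff₀ (by positivity)] at hd
  refine absurd hd (not_lt.2 ?_)
  have hsub : wordCylinder τ P w M ≤ᵐ[volume]
      ⋃ ℓ ∈ Finset.Icc (-(M : ℤ)) M, rot τ ℓ ⁻¹' symmDiff (P (w ℓ)) (R (w ℓ)) := by
    filter_upwards [ae_exists_trajectory τ (openPartitions_subset hQ)] with t ⟨q, hq⟩ ht
    obtain ⟨ℓ, hℓ, hne⟩ := hw q
    refine mem_iUnion₂.2 ⟨ℓ, hℓ, Or.inl ⟨mem_iInter₂.1 ht ℓ hℓ, fun hmem => hne ?_⟩⟩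
    exact ((mem_iff_of_mem hR'.2.1 (hq.induced hφ ℓ) _).1 hmem).symm
  have hterm : ∀ ℓ : ℤ, volume.real (rot τ ℓ ⁻¹' symmDiff (P (w ℓ)) (R (w ℓ))) ≤
      symmDiffDist P R := fun ℓ => by
    rw [measureReal_def, volume_preimage_rot]
    exact Finset.single_le_sum (f := fun a => volume.real (symmDiff (P a) (R a)))
      (fun _ _ => measureReal_nonneg) (Finset.mem_univ (w ℓ))
  calc volume.real (wordCylinder τ P w M)
      ≤ volume.real (⋃ ℓ ∈ Finset.Icc (-(M : ℤ)) M, rot τ ℓ ⁻¹' symmDiff (P (w ℓ)) (R (w ℓ))) :=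
        ENNReal.toReal_mono (measure_ne_top _ _) (measure_mono_ae hsub)
    _ ≤ ∑ ℓ ∈ Finset.Icc (-(M : ℤ)) M,
          volume.real (rot τ ℓ ⁻¹' symmDiff (P (w ℓ)) (R (w ℓ))) :=
        measureReal_biUnion_finset_le _ _
    _ ≤ ∑ ℓ ∈ Finset.Icc (-(M : ℤ)) M, symmDiffDist P R := Finset.sum_le_sum fun ℓ _ => hterm ℓ
    _ = symmDiffDist P R * (2 * M + 1) := by
        rw [Finset.sum_const, Int.card_Icc, nsmul_eq_mul,
          show ((M : ℤ) + 1 - -M).toNat = 2 * M + 1 by omega, mul_comm]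
        push_cast
        rfl

theorem surjective_of_isDenseIn_besicovitchDist [Finite 𝒜] [TopologicalSpace 𝒜]
    [DiscreteTopology 𝒜] {τ : ℤ →+ Torus K} (hτ : Function.Injective τ) (hdense : DenseRange τ)
    {Φ : (ℤ → 𝒜) → (ℤ → 𝒜)} (hΦ : IsCellularAutomaton Φ)
    (h : IsDenseIn besicovitchDist (Φ '' quasisturmian 𝒜 τ) (quasisturmian 𝒜 τ)) :
    Function.Surjective Φ := by
  by_contra hns
  obtain ⟨M, w, hw⟩ := exists_forbidden_word hΦ.continuous hns
  obtain ⟨P, hP, hC, h0, p, hp⟩ := exists_openPartition_isOpen_wordCylinder hτ w M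
  obtain ⟨m, hm⟩ := exists_finite_recurrence hdense hC ⟨0, h0⟩
  -- An interval of length `m + 2 * M + 1` leaves room for a cylinder visit, with gap bound `m`, and
  -- for the whole word of radius `M` around it.
  have hL : (0 : ℝ) < 1 / (2 * (m + 2 * M + 1 : ℕ)) := by positivity
  obtain ⟨_, ⟨q, -, rfl⟩, hd⟩ := h.2 p ⟨P, hP, 0, hp⟩ _ hL
  refine absurd hd (not_lt.2 (le_upperDensity_of_syndetic (by omega) fun ℓ => ?_))
  obtain ⟨i, hi, hmem⟩ := hm (rot τ (ℓ + (m + M : ℕ)) 0)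
  rw [rot_rot] at hmem
  set n : ℤ := ℓ + (m + M : ℕ) + -(i : ℤ) with hn
  -- Shifting moves the visit time `n` to the origin, where the forbidden word is tested.
  obtain ⟨k, hk, hne⟩ := hw (shift (-n) q)
  have hpk : p (n + k) = w k := by
    have := mem_iInter₂.1 hmem k hk
    rw [mem_preimage, rot_rot] at this
    exact ((mem_iff_of_mem hP.2.1 (hp (n + k)) _).1 this).symm
  rw [← hΦ.shift_comm, shift, sub_neg_eq_add, add_comm k] at hne
  have := Finset.mem_Icc.1 hk
  exact ⟨n + k, fun he => hne (he.symm.trans hpk), by omega, by omega⟩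

end QuasiSturm

end

theorem theorem9p2 {𝒜 : Type*} [Fintype 𝒜] [TopologicalSpace 𝒜] [DiscreteTopology 𝒜]
    (K : ℕ) (hK : 1 ≤ K) (τ : ℤ →+ QuasiSturm.Torus K)
    (hτ : Function.Injective τ) (hdense : DenseRange τ)
    (Φ : (ℤ → 𝒜) → (ℤ → 𝒜)) (hΦ : QuasiSturm.IsCellularAutomaton Φ)
    (B : Finset ℤ) (φ : (B → 𝒜) → 𝒜) (hφ : QuasiSturm.IsLocalMap Φ B φ) :
    List.TFAE [
      Function.Surjective Φ,
      QuasiSturm.IsDenseIn QuasiSturm.symmDiffDist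
          (QuasiSturm.inducedMap τ B φ '' QuasiSturm.measPartitions 𝒜 K)
          (QuasiSturm.measPartitions 𝒜 K) ∧
        QuasiSturm.IsDenseIn QuasiSturm.symmDiffDist
          (QuasiSturm.inducedMap τ B φ '' QuasiSturm.openPartitions 𝒜 K)
          (QuasiSturm.openPartitions 𝒜 K),
      QuasiSturm.IsDenseIn QuasiSturm.besicovitchDist
        (Φ '' QuasiSturm.quasisturmian 𝒜 τ) (QuasiSturm.quasisturmian 𝒜 τ),
      QuasiSturm.IsDenseIn QuasiSturm.cantorDist
        (Φ '' QuasiSturm.quasisturmian 𝒜 τ) (QuasiSturm.quasisturmian 𝒜 τ)] := by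
  tfae_have 1 → 2 := fun h =>
    ⟨QuasiSturm.isDenseIn_measPartitions_of_surjective hτ hdense hφ h,
      QuasiSturm.isDenseIn_openPartitions_of_surjective hτ hdense hφ h⟩
  tfae_have 2 → 1 := fun h =>
    QuasiSturm.surjective_of_isDenseIn_symmDiffDist hτ hΦ.continuous hφ h.2
  tfae_have 1 → 3 := QuasiSturm.isDenseIn_besicovitchDist_of_surjective hτ hdense hφ
  tfae_have 3 → 1 := QuasiSturm.surjective_of_isDenseIn_besicovitchDist hτ hdense hΦ
  tfae_have 1 → 4 := QuasiSturm.isDenseIn_cantorDist_of_surjective hτ hφ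
  tfae_have 4 → 1 := QuasiSturm.surjective_of_isDenseIn_cantorDist hτ hΦ.continuous
  tfae_finish
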